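/- Setting. A market has $2n$ buyers and $2n$ sellers ($n\ge 1$), and $k$ divides $n$. The treatment vectors $w^B,w^S\in\{0,1\}^{2n}$ are independent, each uniform over the vectors with exactly $n$ ones (two-sided complete randomization), and $\mathbf W=w^B(w^S)^\top$ is independent of the (random) schedule of potential outcomes $\mathbf w\mapsto \mathbf Y(\mathbf w)\in\mathbb R^{2n\times 2n}$. Let $\mathcal C=(\mathcal U,\mathcal W)$ be a $k$-block conditioning event: buyers and sellers are partitioned into $2n/k$ blocks $\mathcal I_s$, $\mathcal J_s$ of size $k$, with treatment constant on each block and equal on $\mathcal I_s$ and $\mathcal J_s$; $\mathcal U=\bigcup_s \mathcal I_s\times\mathcal J_s$; and $\mathcal W$ is the set of assignments of the design with $w^B_i=w^S_j$ for all $(i,j)\in\mathcal U$. So $|\mathcal U|=2nk$ and $|\mathcal W|=\binom{2n/k}{n/k}$. Given $\mathcal C$, $\mathbf W^{obs}$ is distributed as $P(\mathbf W\mid\mathcal C)$, the design conditioned on $\mathcal W$, and $\mathbf Y^{obs}=\mathbf Y(\mathbf W^{obs})$. For a test statistic $T(\mathbf W\mid\mathbf Y,\mathcal C)$ and a level $\alpha\in(0,1)$,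 the $k$-block test draws $L$ independent uniform permutations of the blocks, applies each of them to the buyer and seller blocks of $\mathbf W^{obs}$ to obtain $\mathbf W^{(1)},\dots,\mathbf W^{(L)}$, and rejects if $\frac1{L+1}\bigl[1+\sum_{l}\mathbb I\{T(\mathbf W^{(l)}\mid\mathbf Y^{obs},\mathcal C)\ge T(\mathbf W^{obs}\mid\mathbf Y^{obs},\mathcal C)\}\bigr]\le\alpha$; the exact test rejects if $P\bigl(T(\mathbf W\mid\mathbf Y^{obs},\mathcal C)\ge T(\mathbf W^{obs}\mid\mathbf Y^{obs},\mathcal C)\bigr)\le\alpha$ for a fresh $\mathbf W\sim P(\cdot\mid\mathcal C)$. Let $\phi$ be the rejection probability, given $\mathcal C$, of either the exact test or the test with $L\ge L_0$ draws. Assumptions. For $\mathbf W\sim P(\mathbf W\mid\mathcal C)$ let $\hat F_1$ and $\hat F_0$ be the (random) distribution functions of $T(\mathbf W\mid\mathbf Y(\mathbf W),\mathcal C)$ and of $T(\mathbf W\mid\mathbf Y^{obs},\mathcal C)$. Fix a continuous cdf $F$. (A.1) There are continuous cdfs $F_1,F_0$ such that $\hat F_1$ and $\hat F_0$ are distributed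 as the empirical distribution functions of $|\mathcal W|$ independent samples from $F_1$ and from $F_0$, respectively. (A.2) $F_0(t)=F(t/\sigma)$ for all $t$, with some $\sigma>0$. (A.3) $F_1(t)=F_0(t-\tau)$ for all $t$, with some $\tau\in\mathbb R$. Claim. Let $F$ and $\alpha$ be fixed. 1. Let $c>0$. There are constants $A,a>0$ such that for every $\delta>0$ there is $K>0$ such that for every $\tau\in\mathbb R$ and $\epsilon>0$ there are $m_0,L_0$ such that every experiment as above with effect $\tau$, $\sigma\le c\,|\mathcal U|^{-1/2}$ and $|\mathcal W|\ge m_0$ satisfies $$\phi\ \ge\ \frac1{1+Ae^{-a\tau\sqrt{\binom{2n/k}{n/k}}}}-K(2nk)^{-1/2+\delta}-\epsilon .$$ 2. Let $c>0$. For every $\delta>0$ there is $K>0$ such that for every $\epsilon>0$ there are $A,a>0$ and $L_0$ such that every experiment as above with $\sigma\le c\,|\mathcal U|^{-1/2}$, for any $n,k,\tau$, satisfies $$\phi\ \ge\ \frac1{1+Ae^{-a\tau\sqrt{2nk}}}-K\binom{2n/k}{n/k}^{-1/2+\delta}-\epsilon .$$ 3. For every $\delta>0$ there is $K>0$ such that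 for every $\epsilon>0$ there are $A,a>0$ and $L_0$ such that every experiment as above, for any $n,k,\tau,\sigma$, satisfies $$\phi\ \ge\ \frac1{1+Ae^{-a\tau/\sigma}}-K\binom{2n/k}{n/k}^{-1/2+\delta}-\epsilon .$$ -/

import Mathlib

open MeasureTheory ProbabilityTheory

universe u

namespace TwoSided

/-- The treatment vectors `(w^B, w^S)` of `2n` buyers and `2n` sellers (`true` is treated).
They stand for the assignment matrix `W = w^B (w^S)ᵀ`. -/
abbrev Assign (n : ℕ) : Type := (Fin (2 * n) → Bool) × (Fin (2 * n) → Bool)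

/-- A matrix of outcomes of the buyer-seller pairs. -/
abbrev Outcomes (n : ℕ) : Type := Fin (2 * n) → Fin (2 * n) → ℝ

/-- The number of treated members of one side of the market. -/
def treated {n : ℕ} (v : Fin (2 * n) → Bool) : ℕ :=
  (Finset.univ.filter fun i => v i = true).card

/-- The two-sided complete randomization design with `I = J = 2n` and `I₁ = J₁ = n`: the two
treatment vectors are independent, each uniform over the vectors with exactly `n` treated. -/
noncomputable def crd (n : ℕ) : Measure (Assign n) :=
  (uniformOn {v : Fin (2 * n) → Bool | treated v = n}).prod
    (uniformOn {v : Fin (2 * n) → Bool | treated v = n})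

/-- The data of a `k`-block conditioning event: an assignment `obs` of the design, and partitions
of the buyers and of the sellers into `2n/k` blocks of size `k`. The members of buyer block `s`
are `buyer (s, p)`, `p : Fin k`, and likewise for the sellers. Treatment is constant in each block,
and it is the same in buyer block `s` and in seller block `s`. -/
structure KBlockEvent (n k : ℕ) where
  obs : Assign n
  obs_buyer : treated obs.1 = n
  obs_seller : treated obs.2 = n
  buyer : Fin (2 * n / k) × Fin k ≃ Fin (2 * n)
  seller : Fin (2 * n / k) × Fin k ≃ Fin (2 * n)
  buyer_const : ∀ s p q, obs.1 (buyer (s, p)) = obs.1 (buyer (s, q))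
  seller_const : ∀ s p q, obs.2 (seller (s, p)) = obs.2 (seller (s, q))
  matched : ∀ s p q, obs.1 (buyer (s, p)) = obs.2 (seller (s, q))

namespace KBlockEvent

variable {n k : ℕ} (C : KBlockEvent n k)

/-- The focal units `𝒰`: pairs in the diagonal blocks whose buyer and seller have equal treatment
under the observed assignment. -/
def focal : Finset (Fin (2 * n) × Fin (2 * n)) :=
  Finset.univ.filter fun ij =>
    C.obs.1 ij.1 = C.obs.2 ij.2 ∧ (C.buyer.symm ij.1).1 = (C.seller.symm ij.2).1

/-- The conditional randomization space `𝒲`: assignments that are possible under the design, that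
preserve the treated numbers on both sides, and with `w^B_i = w^S_j` for all focal `(i, j)`. -/
def assignments : Finset (Assign n) :=
  Finset.univ.filter fun w =>
    (∀ ij ∈ C.focal, w.1 ij.1 = w.2 ij.2) ∧
    (treated w.1 = n ∧ treated w.2 = n) ∧
    (treated w.1 = treated C.obs.1 ∧ treated w.2 = treated C.obs.2)

/-- `P(W | 𝒞)`: the design conditioned on `W ∈ 𝒲`. -/
noncomputable def law : Measure (Assign n) :=
  ProbabilityTheory.cond (crd n) (C.assignments : Set (Assign n))

/-- Block-wise permutation of an assignment: blocks `s` receive the treatments of blocks `π s`. -/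
def permute (π : Equiv.Perm (Fin (2 * n / k))) (w : Assign n) : Assign n :=
  (fun i => w.1 (C.buyer (π (C.buyer.symm i).1, (C.buyer.symm i).2)),
   fun j => w.2 (C.seller (π (C.seller.symm j).1, (C.seller.symm j).2)))

end KBlockEvent

/-- An experiment with a `k`-block conditioning event: a random schedule `Y` of potential outcomes
(`Y ω w` is the outcome matrix under the assignment `w`) and a test statistic `T w y`, the
statistic `T(W ∣ Y, 𝒞)` at the assignment `w` and the outcome matrix `y`. -/
structure Experiment (n k : ℕ) where
  Ω : Type u
  mΩ : MeasurableSpace Ω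
  P : Measure Ω
  isProb : IsProbabilityMeasure P
  event : KBlockEvent n k
  Y : Ω → Assign n → Outcomes n
  measurable_Y : ∀ w, Measurable fun ω => Y ω w
  T : Assign n → Outcomes n → ℝ
  measurable_T : ∀ w, Measurable (T w)

attribute [instance] Experiment.mΩ Experiment.isProb

namespace Experiment

variable {n k : ℕ} (E : Experiment.{u} n k)

/-- The joint law of the potential outcomes and the observed assignment, given `𝒞`: treatment is
randomized, so the observed assignment is independent of the potential outcomes. -/
noncomputable def dataLaw : Measure (E.Ω × Assign n) := E.P.prod E.event.law

/-- Observed outcomes `Y^obs = Y(W^obs)`. -/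
def Yobs (z : E.Ω × Assign n) : Outcomes n := E.Y z.1 z.2

/-- The observed statistic `T(W^obs ∣ Y^obs, 𝒞)`. -/
def Tobs (z : E.Ω × Assign n) : ℝ := E.T z.2 (E.Yobs z)

/-- The (random) cdf of `T(W ∣ Y(W), 𝒞)` for `W ∼ P(W ∣ 𝒞)`. -/
noncomputable def F1hat (ω : E.Ω) (t : ℝ) : ℝ :=
  E.event.law.real {w | E.T w (E.Y ω w) ≤ t}

/-- The (random) cdf of `T(W ∣ Y^obs, 𝒞)` for `W ∼ P(W ∣ 𝒞)`. -/
noncomputable def F0hat (z : E.Ω × Assign n) (t : ℝ) : ℝ :=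
  E.event.law.real {w | E.T w (E.Yobs z) ≤ t}

/-- The p-value of the test with the `L` block permutations `π 0, …, π (L - 1)`. -/
noncomputable def pValue {L : ℕ} (z : E.Ω × Assign n)
    (π : Fin L → Equiv.Perm (Fin (2 * n / k))) : ℝ :=
  (1 + ((Finset.univ.filter fun l =>
      E.Tobs z ≤ E.T (E.event.permute (π l) z.2) (E.Yobs z)).card : ℝ)) / (L + 1)

/-- The power, given `𝒞`, of the test at level `α` with `L` independent uniformly random block
permutations: the probability that the p-value is at most `α`. -/
noncomputable def power (α : ℝ) (L : ℕ) : ℝ :=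
  ∫ z, ((Finset.univ.filter fun π : Fin L → Equiv.Perm (Fin (2 * n / k)) =>
      E.pValue z π ≤ α).card : ℝ)
    / (Fintype.card (Fin L → Equiv.Perm (Fin (2 * n / k))) : ℝ) ∂E.dataLaw

/-- The power, given `𝒞`, of the test that uses the whole randomization distribution: it rejects
if `P(T(W ∣ Y^obs, 𝒞) ≥ T(W^obs ∣ Y^obs, 𝒞)) ≤ α` for `W ∼ P(W ∣ 𝒞)`. -/
noncomputable def exactPower (α : ℝ) : ℝ :=
  E.dataLaw.real {z | E.event.law.real {w | E.Tobs z ≤ E.T w (E.Yobs z)} ≤ α}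

/-- `b` bounds from below the power of the exact test, and of the test with any number `L ≥ L₀`
of random permutations. -/
def PowerAtLeast (α : ℝ) (L₀ : ℕ) (b : ℝ) : Prop :=
  b ≤ E.exactPower α ∧ ∀ L : ℕ, L₀ ≤ L → b ≤ E.power α L

end Experiment

/-- The empirical distribution function of a sample. -/
noncomputable def ecdf {m : ℕ} (x : Fin m → ℝ) (t : ℝ) : ℝ :=
  ((Finset.univ.filter fun j => x j ≤ t).card : ℝ) / m

/-- The distributional assumptions, with base cdf `cdf F`, scale `σ` and additive effect `τ`.
The first two lines of the body say that there are continuous cdfs `F₁`, `F₀` such that the random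
functions `F1hat` and `F0hat` are distributed as the empirical cdfs of `m = |𝒲|` independent
samples from `F₁` and from `F₀`. -/
def PowerAssumptions {n k : ℕ} (E : Experiment.{u} n k) (F : Measure ℝ) (σ τ : ℝ) : Prop :=
  ∃ F₁ F₀ : ProbabilityMeasure ℝ,
    Continuous (cdf (F₁ : Measure ℝ)) ∧ Continuous (cdf (F₀ : Measure ℝ)) ∧
    IdentDistrib E.F1hat ecdf E.P
      (Measure.pi fun _ : Fin E.event.assignments.card => (F₁ : Measure ℝ)) ∧
    IdentDistrib E.F0hat ecdf E.dataLaw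
      (Measure.pi fun _ : Fin E.event.assignments.card => (F₀ : Measure ℝ)) ∧
    0 < σ ∧ (∀ t, cdf (F₀ : Measure ℝ) t = cdf F (t / σ)) ∧
    (∀ t, cdf (F₁ : Measure ℝ) t = cdf (F₀ : Measure ℝ) (t - τ))

end TwoSided

/-!
The bound rests on a single point of the randomization distribution. Write `M = |𝒲|` and let `q` be
the upper `α/2` point of `F`. The observed statistic is a uniform pick from the statistics
`T(W ∣ Y(W), 𝒞)`, hence it has cdf exactly `F₁`, and it exceeds `σq` with probability
`1 - F(q - τ/σ)` (`dataLaw_real_Tobs_le`). By Chebyshev's inequality the empirical cdf `F0hat` at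
`σq` falls below `1 - 3α/4` with probability at most `4/(α²M)`. When the statistic exceeds `σq` and
`F0hat` is not that low there, the exact p-value is at most `3α/4` (`le_dataLaw_real_pValue_le`); a
union bound suffices, so the dependence between the observed statistic and `F0hat` is harmless. A
uniform block permutation of an assignment in `𝒲` is distributed as `P(W ∣ 𝒞)` (`card_permute_div`),
because permutations act transitively on the block treatments with half of the blocks treated. So
the frequency of exceedances in the `L` draws is within `α/8` of the exact p-value outside of an
event of probability at most `16/(α²L)`, by Chebyshev once more. Altogether
`φ ≥ 1 - F(q - τ/σ) - 4/(α²M) - ε` for `L ≥ L₀(ε)` (`exists_forall_powerAtLeast`).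

The logistic forms follow by comparison. Where `τ/σ` is large, `F(q - τ/σ)` is below `ε`; elsewhere
a large `A` makes the logistic term at most `ε`, and `4/(α²M)` is at most `K M^(-1/2+δ)` as `M ≥ 1`.
For the first claim `A` may not depend on `ε`, but `M` may be taken large after `τ`: `M ≤ 2^(2n/k)`
then makes `2nk` large and `σ` small, so the power is eventually close to `1` for `τ > 0` and at
least `α/2 - ε` for `τ = 0`, where `A = 2/α - 1` makes the logistic term `α/2`.
-/

namespace TwoSided

/-! ### Frequencies in independent samples -/

section Frequency

variable {X : Type*} [MeasurableSpace X] (μ : Measure X) [IsProbabilityMeasure μ]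
  {p : X → Prop} {m : ℕ}

theorem memLp_pi_indicator_eval (hp : MeasurableSet {x | p x}) (j : Fin m) :
    MemLp (fun x : Fin m → X => {x | p x}.indicator (1 : X → ℝ) (x j)) 2
      (Measure.pi fun _ : Fin m => μ) :=
  (memLp_indicator_const 2 hp (1 : ℝ) (.inr (measure_ne_top μ _))).comp_measurePreserving
    (measurePreserving_eval _ j)

variable [DecidablePred p]

omit [MeasurableSpace X] in
theorem sum_indicator_eval (x : Fin m → X) :
    ∑ j, {x | p x}.indicator (1 : X → ℝ) (x j)
      = ((Finset.univ.filter fun j => p (x j)).card : ℝ) := by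
  simp [Set.indicator_apply]

theorem integral_pi_card_filter (hp : MeasurableSet {x | p x}) :
    ∫ x, ((Finset.univ.filter fun j => p (x j)).card : ℝ) ∂(Measure.pi fun _ : Fin m => μ)
      = m * μ.real {x | p x} := by
  have hj : ∀ j : Fin m, ∫ x, {x | p x}.indicator (1 : X → ℝ) (x j)
      ∂(Measure.pi fun _ : Fin m => μ) = μ.real {x | p x} := fun j => by
    rw [integral_comp_eval (X := fun _ : Fin m => X) (μ := fun _ => μ) (i := j)
      (f := {x | p x}.indicator (1 : X → ℝ))
      (measurable_one.indicator hp).aestronglyMeasurable, integral_indicator_one hp]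
  simp_rw [← sum_indicator_eval]
  rw [integral_finsetSum _ fun j _ => (memLp_pi_indicator_eval μ hp j).integrable (by norm_num)]
  simp [hj]

/-- Chebyshev's inequality for the frequency of an event in `m` independent draws; the variance of
an indicator is at most `1 / 4`. -/
theorem pi_real_abs_frequency_sub_ge_le (hp : MeasurableSet {x | p x}) (hm : 0 < m)
    {η : ℝ} (hη : 0 < η) :
    (Measure.pi fun _ : Fin m => μ).real
        {x | η ≤ |((Finset.univ.filter fun j => p (x j)).card : ℝ) / m - μ.real {x | p x}|}
      ≤ 1 / (4 * m * η ^ 2) := by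
  have hm' : (0 : ℝ) < m := by exact_mod_cast hm
  set f : X → ℝ := {x | p x}.indicator 1 with hf
  have hvar : Var[f; μ] ≤ 1 / 4 := by
    refine (variance_le_sq_of_bounded (a := 0) (b := 1) (.of_forall fun x => ?_)
      (measurable_one.indicator hp).aemeasurable).trans_eq (by norm_num)
    by_cases hx : p x <;> simp [hx]
  have hfL : MemLp f 2 μ := memLp_indicator_const 2 hp (1 : ℝ) (.inr (measure_ne_top μ _))
  have hsum : Var[∑ j : Fin m, fun x : Fin m → X => f (x j); Measure.pi fun _ => μ]
      = m * Var[f; μ] := by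
    rw [variance_sum_pi (X := fun _ => f) fun _ => hfL]
    simp
  have hL : MemLp (∑ j : Fin m, fun x : Fin m → X => f (x j)) 2 (Measure.pi fun _ => μ) :=
    memLp_finsetSum' _ fun j _ => memLp_pi_indicator_eval μ hp j
  have hcheb := meas_ge_le_variance_div_sq hL (mul_pos hm' hη)
  rw [hsum] at hcheb
  simp only [Finset.sum_apply, hf, sum_indicator_eval, integral_pi_card_filter μ hp] at hcheb
  have hscale : ∀ y : ℝ, m * η ≤ |y - m * μ.real {x | p x}|
      ↔ η ≤ |y / m - μ.real {x | p x}| := fun y => by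
    rw [← mul_le_mul_iff_right₀ hm' (b := η), ← abs_of_pos hm', ← abs_mul, abs_of_pos hm']
    field_simp
  simp only [hscale] at hcheb
  refine (ENNReal.toReal_le_of_le_ofReal (by have := variance_nonneg f μ; positivity) hcheb).trans
    ?_
  calc m * Var[f; μ] / (m * η) ^ 2 ≤ m * (1 / 4) / (m * η) ^ 2 := by gcongr
    _ = 1 / (4 * m * η ^ 2) := by field_simp

end Frequency

theorem uniformOn_univ_real {Z : Type*} [Fintype Z] [MeasurableSpace Z]
    [MeasurableSingletonClass Z] (q : Z → Prop) [DecidablePred q] :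
    (uniformOn (Set.univ : Set Z)).real {z | q z}
      = ((Finset.univ.filter q).card : ℝ) / Fintype.card Z := by
  have : {z | q z} = ((Finset.univ.filter q : Finset Z) : Set Z) := by ext; simp
  rw [this, measureReal_def, uniformOn_univ, Measure.count_apply_finset]
  simp

/-- Chebyshev's inequality for the frequency of a property in `L` uniform draws from a finite
type, as a count of samples. -/
theorem card_abs_frequency_sub_ge_div_le {X : Type*} [Fintype X] [Nonempty X] (p : X → Prop)
    [DecidablePred p] {L : ℕ} (hL : 0 < L) {η : ℝ} (hη : 0 < η) :
    ((Finset.univ.filter fun x : Fin L → X =>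
        η ≤ |((Finset.univ.filter fun l => p (x l)).card : ℝ) / L
          - ((Finset.univ.filter p).card : ℝ) / Fintype.card X|).card : ℝ)
      / Fintype.card (Fin L → X) ≤ 1 / (4 * L * η ^ 2) := by
  classical
  let _ : MeasurableSpace X := ⊤
  have h := pi_real_abs_frequency_sub_ge_le (uniformOn (Set.univ : Set X)) (p := p)
    .of_discrete hL hη
  rw [← uniformOn_pi, Set.pi_univ, uniformOn_univ_real, uniformOn_univ_real] at h
  exact h

/-! ### Block conditioning events and block permutations -/

/-- The uniform measure on a product of two sets is the product of the uniform measures. -/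
theorem uniformOn_prod_eq {X Y : Type*} [Finite X] [Finite Y]
    [MeasurableSpace X] [MeasurableSpace Y] [MeasurableSingletonClass X]
    [MeasurableSingletonClass Y] (s : Set X) (t : Set Y) :
    uniformOn (s ×ˢ t) = (uniformOn s).prod (uniformOn t) := by
  classical
  refine (Measure.prod_eq fun u v _ _ => ?_).symm
  lift s to Finset X using s.toFinite
  lift t to Finset Y using t.toFinite
  lift u to Finset X using u.toFinite
  lift v to Finset Y using v.toFinite
  rw [← Finset.coe_product, ← Finset.coe_product, uniformOn_apply_finset, uniformOn_apply_finset,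
    uniformOn_apply_finset, Finset.product_inter_product, Finset.card_product,
    Finset.card_product, Nat.cast_mul, Nat.cast_mul, ENNReal.mul_div_mul_comm] <;> simp

/-- Permuting a 0-1 vector uniformly at random gives a uniform vector among those with as many
ones: the permutation group acts transitively on them, so all fibres of `π ↦ b ∘ π` have the size
of the stabilizer of `b`. -/
theorem card_perm_comp_eq {N : ℕ} (b : Fin N → Bool) (Q : (Fin N → Bool) → Prop)
    [DecidablePred Q] :
    ((Finset.univ.filter fun π : Equiv.Perm (Fin N) => Q (b ∘ π)).card : ℝ)
        / Fintype.card (Equiv.Perm (Fin N))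
      = ((Finset.univ.filter fun b' : Fin N → Bool =>
            (Finset.univ.filter fun s => b' s = true).card
              = (Finset.univ.filter fun s => b s = true).card ∧ Q b').card : ℝ)
        / (Finset.univ.filter fun b' : Fin N → Bool =>
            (Finset.univ.filter fun s => b' s = true).card
              = (Finset.univ.filter fun s => b s = true).card).card := by
  classical
  set B := Finset.univ.filter fun b' : Fin N → Bool =>
            (Finset.univ.filter fun s => b' s = true).card
              = (Finset.univ.filter fun s => b s = true).card with hB
  set c := (Finset.univ.filter fun π : Equiv.Perm (Fin N) => b ∘ π = b).card with hc
  have hmaps : ∀ π : Equiv.Perm (Fin N), b ∘ π ∈ B := fun π => by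
    simp only [hB, Finset.mem_filter, Finset.mem_univ, true_and]
    exact Finset.card_equiv π (by simp)
  have hfib : ∀ b' ∈ B,
      (Finset.univ.filter fun π : Equiv.Perm (Fin N) => b ∘ π = b').card = c := by
    intro b' hb'
    obtain ⟨ρ, hρ⟩ := Equiv.Perm.exists_map_finset_eq _ _ (Finset.mem_filter.1 hb').2
    have hbρ : b ∘ ρ = b' := by
      funext s
      have h1 : ρ s ∈ (Finset.univ.filter fun s => b s = true) ↔
          s ∈ (Finset.univ.filter fun s => b' s = true) := by
        rw [← hρ]; simp
      simp only [Finset.mem_filter, Finset.mem_univ, true_and] at h1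
      exact Bool.eq_iff_iff.2 h1
    refine Finset.card_equiv (Equiv.mulRight ρ⁻¹) fun π => ?_
    simp only [Finset.mem_filter, Finset.mem_univ, true_and, Equiv.coe_mulRight,
      Equiv.Perm.coe_mul, ← hbρ, funext_iff, Function.comp_apply]
    refine ⟨fun h s => by simpa using h (ρ⁻¹ s), fun h s => by simpa using h (ρ s)⟩
  have hcount : ∀ (R : (Fin N → Bool) → Prop) [DecidablePred R],
      (Finset.univ.filter fun π : Equiv.Perm (Fin N) => R (b ∘ π)).card
        = (B.filter R).card * c := by
    intro R _
    rw [Finset.card_eq_sum_card_fiberwise (f := fun π : Equiv.Perm (Fin N) => b ∘ π)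
      (t := B.filter R) (fun π hπ => by simpa using ⟨hmaps π, by simpa using hπ⟩),
      Finset.sum_const_nat]
    intro b' hb'
    rw [← hfib b' (Finset.mem_filter.1 hb').1, Finset.filter_filter]
    congr 1
    ext π
    simp only [Finset.mem_filter, Finset.mem_univ, true_and, and_iff_right_iff_imp]
    rintro rfl
    exact (Finset.mem_filter.1 hb').2
  have hc0 : (c : ℝ) ≠ 0 := by
    have : 0 < c := Finset.card_pos.2 ⟨1, by simp⟩
    exact_mod_cast this.ne'
  have h1 := hcount Q
  have h2 : Fintype.card (Equiv.Perm (Fin N)) = B.card * c := by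
    have := hcount fun _ => True
    simpa using this
  rw [h1, h2, ← Finset.filter_filter]
  push_cast
  rw [mul_div_mul_right _ _ hc0]

theorem treated_comp_fst {n N k : ℕ} (e : Fin N × Fin k ≃ Fin (2 * n)) (b : Fin N → Bool) :
    treated (fun i => b (e.symm i).1) = (Finset.univ.filter fun s => b s = true).card * k := by
  have : treated (fun i => b (e.symm i).1)
      = ((Finset.univ.filter fun s => b s = true) ×ˢ (Finset.univ : Finset (Fin k))).card :=
    Finset.card_equiv e.symm (by simp)
  rw [this, Finset.card_product, Finset.card_univ, Fintype.card_fin]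

theorem choose_blocks_pos (n k : ℕ) : 0 < (2 * n / k).choose (n / k) :=
  Nat.choose_pos (Nat.div_le_div_right (by lia))

namespace KBlockEvent

variable {n k : ℕ} (C : KBlockEvent n k)

/-- The assignment in which buyer block `s` and seller block `s` have the treatment `b s`. -/
def ofBlocks (b : Fin (2 * n / k) → Bool) : Assign n :=
  (fun i => b (C.buyer.symm i).1, fun j => b (C.seller.symm j).1)

theorem permute_ofBlocks (b : Fin (2 * n / k) → Bool) (π : Equiv.Perm (Fin (2 * n / k))) :
    C.permute π (C.ofBlocks b) = C.ofBlocks (b ∘ π) := by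
  simp [permute, ofBlocks]

theorem ofBlocks_injective (hk : 0 < k) : Function.Injective C.ofBlocks := by
  intro b b' h
  funext s
  have := congrFun (congrArg Prod.fst h) (C.buyer (s, ⟨0, hk⟩))
  simpa [ofBlocks] using this

/-- The condition of equal treatment in `focal` is implied by that of equal blocks. -/
theorem mem_focal {ij : Fin (2 * n) × Fin (2 * n)} :
    ij ∈ C.focal ↔ (C.buyer.symm ij.1).1 = (C.seller.symm ij.2).1 := by
  simp only [focal, Finset.mem_filter, Finset.mem_univ, true_and, and_iff_right_iff_imp]
  intro h
  have := C.matched (C.buyer.symm ij.1).1 (C.buyer.symm ij.1).2 (C.seller.symm ij.2).2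
  rwa [Prod.mk.eta, Equiv.apply_symm_apply, h, Prod.mk.eta, Equiv.apply_symm_apply] at this

variable (n k) in
/-- The block treatments with half of the blocks treated. -/
def balanced : Finset (Fin (2 * n / k) → Bool) :=
  Finset.univ.filter fun b => (Finset.univ.filter fun s => b s = true).card = n / k

/-- An assignment lies in `𝒲` iff it is constant on matched blocks with half of the blocks
treated. -/
theorem assignments_eq (hn : 0 < n) (hkn : k ∣ n) :
    C.assignments = (balanced n k).map ⟨C.ofBlocks, C.ofBlocks_injective
      (Nat.pos_of_dvd_of_pos hkn hn)⟩ := by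
  have hk := Nat.pos_of_dvd_of_pos hkn hn
  have hcard : ∀ b : Fin (2 * n / k) → Bool,
      (Finset.univ.filter fun s => b s = true).card * k = n ↔ b ∈ balanced n k := fun b => by
    rw [balanced, Finset.mem_filter, eq_comm, ← Nat.div_eq_iff_eq_mul_left hk hkn, eq_comm]
    simp
  ext w
  simp only [assignments, Finset.mem_filter, Finset.mem_univ, true_and, Finset.mem_map,
    Function.Embedding.coeFn_mk, C.obs_buyer, C.obs_seller, and_self, mem_focal]
  constructor
  · rintro ⟨hw, hB, -⟩
    have heq : C.ofBlocks (fun s => w.1 (C.buyer (s, ⟨0, hk⟩))) = w := by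
      refine Prod.ext (funext fun i => ?_) (funext fun j => ?_)
      · -- both buyers agree with a common seller of their block
        have h1 := hw (i, C.seller ((C.buyer.symm i).1, ⟨0, hk⟩)) (by simp)
        have h2 := hw (C.buyer ((C.buyer.symm i).1, ⟨0, hk⟩),
          C.seller ((C.buyer.symm i).1, ⟨0, hk⟩)) (by simp)
        exact h2.trans h1.symm
      · exact hw (C.buyer ((C.seller.symm j).1, ⟨0, hk⟩), j) (by simp)
    refine ⟨_, (hcard _).1 ?_, heq⟩
    rw [← treated_comp_fst C.buyer]
    exact (congrArg (fun v : Assign n => treated v.1) heq).trans hB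
  · rintro ⟨b, hb, rfl⟩
    have := (hcard b).2 hb
    refine ⟨fun ij h => by simp [ofBlocks, h], ?_⟩
    simp only [ofBlocks]
    exact ⟨(treated_comp_fst _ _).trans this, (treated_comp_fst _ _).trans this⟩

theorem card_balanced : (balanced n k).card = (2 * n / k).choose (n / k) := by
  have h := Finset.card_powersetCard (n / k) (Finset.univ : Finset (Fin (2 * n / k)))
  rw [Finset.card_univ, Fintype.card_fin] at h
  rw [← h]
  refine Finset.card_bij (fun b _ => Finset.univ.filter fun s => b s = true) ?_ ?_ ?_
  · intro b hb
    simpa [balanced] using hb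
  · intro b _ b' _ h
    funext s
    have := Finset.ext_iff.1 h s
    simpa [← Bool.eq_iff_iff] using this
  · intro t ht
    refine ⟨fun s => decide (s ∈ t), ?_, ?_⟩
    · simpa [balanced] using ht
    · simp

theorem card_assignments (hn : 0 < n) (hkn : k ∣ n) :
    C.assignments.card = (2 * n / k).choose (n / k) := by
  rw [C.assignments_eq hn hkn, Finset.card_map, card_balanced]

theorem obs_mem_assignments : C.obs ∈ C.assignments := by
  simp only [assignments, Finset.mem_filter, Finset.mem_univ, true_and, C.obs_buyer,
    C.obs_seller, and_self, and_true, focal]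
  exact fun _ h => h.1

theorem law_eq_uniformOn : C.law = uniformOn (C.assignments : Set (Assign n)) := by
  have hcrd : crd n = uniformOn ({v : Fin (2 * n) → Bool | treated v = n} ×ˢ
      {v : Fin (2 * n) → Bool | treated v = n}) := (uniformOn_prod_eq _ _).symm
  have hsub : (C.assignments : Set (Assign n)) ⊆ {v : Fin (2 * n) → Bool | treated v = n} ×ˢ
      {v : Fin (2 * n) → Bool | treated v = n} := by
    intro w hw
    have := Finset.mem_coe.1 hw
    simp only [assignments, Finset.mem_filter] at this
    exact this.2.2.1
  rw [law, hcrd, uniformOn, cond_cond_eq_cond_inter' (Set.toFinite _).measurableSet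
    (Set.toFinite _).measurableSet (by simp), Set.inter_eq_self_of_subset_right hsub, uniformOn]

instance : IsProbabilityMeasure C.law := by
  rw [law_eq_uniformOn]
  exact isProbabilityMeasure_uniformOn (Set.toFinite _) ⟨_, C.obs_mem_assignments⟩

/-- A uniform block permutation of any member of `𝒲` is distributed as `P(W ∣ 𝒞)`. -/
theorem card_permute_div (hn : 0 < n) (hkn : k ∣ n) {w : Assign n} (hw : w ∈ C.assignments)
    (S : Set (Assign n)) [DecidablePred (· ∈ S)] :
    ((Finset.univ.filter fun π : Equiv.Perm (Fin (2 * n / k)) => C.permute π w ∈ S).card : ℝ)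
        / Fintype.card (Equiv.Perm (Fin (2 * n / k))) = C.law.real S := by
  classical
  have hass := C.assignments_eq hn hkn
  rw [hass] at hw
  obtain ⟨b, hb, rfl⟩ := Finset.mem_map.1 hw
  have hS : S = ((Finset.univ.filter (· ∈ S) : Finset (Assign n)) : Set (Assign n)) := by
    ext; simp
  rw [law_eq_uniformOn]
  conv_rhs => rw [hS]
  rw [measureReal_def, uniformOn_apply_finset, hass, Finset.card_map]
  simp only [Function.Embedding.coeFn_mk, permute_ofBlocks]
  rw [card_perm_comp_eq b fun b => C.ofBlocks b ∈ S]
  have hb' : (Finset.univ.filter fun s => b s = true).card = n / k := by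
    simpa [balanced] using hb
  rw [hb', ← Finset.filter_filter, Finset.inter_filter, Finset.inter_univ, Finset.filter_map,
    Finset.card_map]
  simp [balanced]

end KBlockEvent

/-! ### The power of the tests -/

namespace Experiment

variable {n k : ℕ} (E : Experiment.{u} n k)

instance : IsProbabilityMeasure E.dataLaw := by
  unfold dataLaw; infer_instance

theorem measurable_statistic (g : Assign n → Assign n) :
    Measurable fun z : E.Ω × Assign n => E.T (g z.2) (E.Yobs z) :=
  measurable_from_prod_countable_left fun w => (E.measurable_T (g w)).comp (E.measurable_Y w)

theorem ae_mem_assignments : ∀ᵐ z ∂E.dataLaw, z.2 ∈ E.event.assignments :=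
  Measure.quasiMeasurePreserving_snd.ae
    (ae_cond_mem (Set.toFinite (E.event.assignments : Set (Assign n))).measurableSet)

theorem exactPower_nonneg (α : ℝ) : 0 ≤ E.exactPower α := measureReal_nonneg

theorem power_nonneg (α : ℝ) (L : ℕ) : 0 ≤ E.power α L :=
  integral_nonneg fun _ => by positivity

theorem powerAtLeast_of_nonpos {α b : ℝ} (hb : b ≤ 0) (L₀ : ℕ) : E.PowerAtLeast α L₀ b :=
  ⟨hb.trans (E.exactPower_nonneg α), fun L _ => hb.trans (E.power_nonneg α L)⟩

variable {E} in
theorem PowerAtLeast.mono {α b b' : ℝ} {L₀ : ℕ} (h : E.PowerAtLeast α L₀ b') (hb : b ≤ b') :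
    E.PowerAtLeast α L₀ b :=
  ⟨hb.trans h.1, fun L hL => hb.trans (h.2 L hL)⟩

/-- If the observed statistic exceeds `t`, the exact p-value is at most the fraction of the
randomization distribution above `t`. -/
theorem law_real_le_of_lt {z : E.Ω × Assign n} {t : ℝ} (ht : t < E.Tobs z) :
    E.event.law.real {w | E.Tobs z ≤ E.T w (E.Yobs z)} ≤ 1 - E.F0hat z t := by
  rw [F0hat, ← probReal_compl_eq_one_sub (Set.toFinite _).measurableSet]
  exact measureReal_mono fun w hw hw' => absurd (ht.trans_le hw) (not_lt.2 hw')

/-- The observed statistic is one uniform pick from the statistics `T(W ∣ Y(W), 𝒞)`, so its cdf is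
the mean of the random cdf `F1hat`. -/
theorem dataLaw_real_Tobs_le (t : ℝ) :
    E.dataLaw.real {z | E.Tobs z ≤ t} = ∫ ω, E.F1hat ω t ∂E.P := by
  have hm : MeasurableSet {z | E.Tobs z ≤ t} :=
    measurableSet_le (E.measurable_statistic id) measurable_const
  rw [measureReal_def, dataLaw, Measure.prod_apply hm,
    ← integral_toReal (measurable_measure_prodMk_left hm).aemeasurable
      (.of_forall fun _ => measure_lt_top _ _)]
  rfl

/-- Given data with exact p-value at most `3α/4`, the randomized test rejects with probability at
least `1 - 16/(α²L)`, as the permuted assignments are independent draws from `P(W ∣ 𝒞)`. -/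
theorem one_sub_le_card_pValue_le (hn : 0 < n) (hkn : k ∣ n) {α : ℝ} (hα : 0 < α) {L : ℕ}
    (hL : 8 / α ≤ L) {z : E.Ω × Assign n} (hz : z.2 ∈ E.event.assignments)
    (hp : E.event.law.real {w | E.Tobs z ≤ E.T w (E.Yobs z)} ≤ 3 * α / 4) :
    1 - 16 / (α ^ 2 * L) ≤ ((Finset.univ.filter fun π : Fin L → Equiv.Perm (Fin (2 * n / k)) =>
        E.pValue z π ≤ α).card : ℝ) / Fintype.card (Fin L → Equiv.Perm (Fin (2 * n / k))) := by
  classical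
  have hL0 : (0 : ℝ) < L := (by positivity : 0 < 8 / α).trans_le hL
  rw [div_le_iff₀ hα] at hL
  have hcheb := card_abs_frequency_sub_ge_div_le
    (fun π => E.Tobs z ≤ E.T (E.event.permute π z.2) (E.Yobs z))
    (Nat.cast_pos.1 hL0) (by positivity : 0 < α / 8)
  have hmean := E.event.card_permute_div hn hkn hz {w | E.Tobs z ≤ E.T w (E.Yobs z)}
  simp only [Set.mem_ofPred_eq] at hmean
  rw [hmean] at hcheb
  set r := E.event.law.real {w | E.Tobs z ≤ E.T w (E.Yobs z)}
  set G := Finset.univ.filter fun π : Fin L → Equiv.Perm (Fin (2 * n / k)) => E.pValue z π ≤ α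
  have hbad : (Gᶜ.card : ℝ) / Fintype.card (Fin L → Equiv.Perm (Fin (2 * n / k)))
      ≤ 16 / (α ^ 2 * L) := by
    refine le_trans ?_ (hcheb.trans_eq (by field_simp; norm_num))
    gcongr
    intro π hπ
    simp only [G, Finset.mem_compl, Finset.mem_filter, Finset.mem_univ, true_and, not_le] at hπ ⊢
    rw [pValue, lt_div_iff₀ (by positivity)] at hπ
    refine le_trans ?_ (le_abs_self _)
    rw [le_sub_iff_add_le, le_div_iff₀ hL0]
    nlinarith
  have hcompl : (Gᶜ.card : ℝ) = Fintype.card (Fin L → Equiv.Perm (Fin (2 * n / k))) - G.card := by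
    rw [Finset.card_compl, Nat.cast_sub (Finset.card_le_univ _)]
  have hN : (0 : ℝ) < Fintype.card (Fin L → Equiv.Perm (Fin (2 * n / k))) := by
    exact_mod_cast Fintype.card_pos
  rw [hcompl, sub_div, div_self hN.ne'] at hbad
  linarith

theorem dataLaw_real_sub_le_power (hn : 0 < n) (hkn : k ∣ n) {α : ℝ} (hα : 0 < α) {L : ℕ}
    (hL : 8 / α ≤ L) :
    E.dataLaw.real {z | E.event.law.real {w | E.Tobs z ≤ E.T w (E.Yobs z)} ≤ 3 * α / 4}
      - 16 / (α ^ 2 * L) ≤ E.power α L := by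
  classical
  set f : E.Ω × Assign n → ℝ := fun z =>
    ((Finset.univ.filter fun π : Fin L → Equiv.Perm (Fin (2 * n / k)) =>
      E.pValue z π ≤ α).card : ℝ) / Fintype.card (Fin L → Equiv.Perm (Fin (2 * n / k))) with hf
  have hf0 : ∀ z, 0 ≤ f z := fun z => by positivity
  have hf1 : ∀ z, f z ≤ 1 := fun z =>
    div_le_one_of_le₀ (by exact_mod_cast Finset.card_le_univ _) (by positivity)
  have hpm : ∀ π : Fin L → Equiv.Perm (Fin (2 * n / k)), Measurable fun z => E.pValue z π := by
    intro π
    simp only [pValue, Finset.card_filter, Nat.cast_sum, Nat.cast_ite, Nat.cast_one, Nat.cast_zero]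
    refine ((Finset.measurable_sum _ fun l _ => Measurable.ite (measurableSet_le
      (E.measurable_statistic id) (E.measurable_statistic _)) measurable_const
      measurable_const).const_add 1).div_const _
  have hfm : Measurable f := by
    simp only [hf, Finset.card_filter, Nat.cast_sum, Nat.cast_ite, Nat.cast_one, Nat.cast_zero]
    exact (Finset.measurable_sum _ fun π _ => Measurable.ite (measurableSet_le (hpm π)
      measurable_const) measurable_const measurable_const).div_const _
  have hfi : Integrable f E.dataLaw :=
    .of_mem_Icc 0 1 hfm.aemeasurable (.of_forall fun z => ⟨hf0 z, hf1 z⟩)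
  have hmarkov := mul_meas_ge_le_integral_of_nonneg (.of_forall hf0) hfi (1 - 16 / (α ^ 2 * L))
  set r := E.dataLaw.real {z | E.event.law.real {w | E.Tobs z ≤ E.T w (E.Yobs z)} ≤ 3 * α / 4}
  have hr : r ≤ E.dataLaw.real {z | 1 - 16 / (α ^ 2 * L) ≤ f z} := by
    refine ENNReal.toReal_mono (measure_ne_top _ _) (measure_mono_ae ?_)
    filter_upwards [E.ae_mem_assignments] with z hz hp
    exact E.one_sub_le_card_pValue_le hn hkn hα hL hz hp
  have hr1 : r ≤ 1 := measureReal_le_one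
  have hr0 : 0 ≤ r := measureReal_nonneg
  have hL0 : 0 ≤ 16 / (α ^ 2 * L) := by positivity
  rcases le_total (16 / (α ^ 2 * L)) 1 with h | h
  · refine le_trans ?_ hmarkov
    nlinarith [mul_le_mul_of_nonneg_left hr (sub_nonneg.2 h)]
  · linarith [E.power_nonneg α L]

/-- The exact p-value is at most `3α/4` when the observed statistic exceeds the upper `α/2` point
`σq` of `F₀` and `F0hat` errs by less than `α/4` there. The first has probability
`1 - F(q - τ/σ)`, the second fails with probability at most `4/(α²|𝒲|)`. -/
theorem le_dataLaw_real_pValue_le (hn : 0 < n) (hkn : k ∣ n) {F : Measure ℝ} {σ τ α q : ℝ}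
    (h : PowerAssumptions E F σ τ) (hα : 0 < α) (hq : cdf F q = 1 - α / 2) :
    1 - cdf F (q - τ / σ) - 4 / (α ^ 2 * (2 * n / k).choose (n / k)) ≤
      E.dataLaw.real {z | E.event.law.real {w | E.Tobs z ≤ E.T w (E.Yobs z)} ≤ 3 * α / 4} := by
  classical
  obtain ⟨F₁, F₀, -, -, h₁, h₀, hσ, hF₀, hF₁⟩ := h
  rw [E.event.card_assignments hn hkn] at h₁ h₀
  set m := (2 * n / k).choose (n / k) with hm
  have hm0 : 0 < m := choose_blocks_pos n k
  have hm' : (0 : ℝ) < m := by exact_mod_cast hm0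
  have hA : E.dataLaw.real {z | E.Tobs z ≤ σ * q} = cdf F (q - τ / σ) := by
    have hcomp := (h₁.comp (measurable_pi_apply (σ * q))).integral_eq
    simp only [Function.comp_apply, ecdf] at hcomp
    rw [dataLaw_real_Tobs_le, hcomp, integral_div,
      integral_pi_card_filter (F₁ : Measure ℝ) measurableSet_Iic, mul_div_cancel_left₀ _ hm'.ne']
    change (F₁ : Measure ℝ).real (Set.Iic _) = _
    rw [← cdf_eq_real, hF₁, hF₀]
    congr 1
    field_simp
  have hB : E.dataLaw.real {z | E.F0hat z (σ * q) < 1 - 3 * α / 4} ≤ 4 / (α ^ 2 * m) := by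
    have hmeas := (h₀.comp (measurable_pi_apply (σ * q))).measure_mem_eq
      (measurableSet_Iio (a := 1 - 3 * α / 4))
    have hcheb := pi_real_abs_frequency_sub_ge_le (F₀ : Measure ℝ) (p := fun x => x ≤ σ * q)
      measurableSet_Iic hm0 (by positivity : 0 < α / 4)
    have hF : (F₀ : Measure ℝ).real {x | x ≤ σ * q} = 1 - α / 2 := by
      change (F₀ : Measure ℝ).real (Set.Iic _) = _
      rw [← cdf_eq_real, hF₀, mul_div_cancel_left₀ _ hσ.ne', hq]
    rw [hF] at hcheb
    calc E.dataLaw.real {z | E.F0hat z (σ * q) < 1 - 3 * α / 4}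
        = (Measure.pi fun _ : Fin m => (F₀ : Measure ℝ)).real
            {x | ecdf x (σ * q) < 1 - 3 * α / 4} := congrArg ENNReal.toReal hmeas
      _ ≤ _ := measureReal_mono fun x (hx : ecdf x (σ * q) < _) => by
          simp only [Set.mem_ofPred_eq]
          rw [ecdf] at hx
          rw [abs_sub_comm]
          refine le_trans ?_ (le_abs_self _)
          linarith
      _ ≤ _ := hcheb
      _ = _ := by field_simp
  have hcover : (Set.univ : Set (E.Ω × Assign n)) ⊆
      ({z | E.event.law.real {w | E.Tobs z ≤ E.T w (E.Yobs z)} ≤ 3 * α / 4}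
        ∪ {z | E.Tobs z ≤ σ * q}) ∪ {z | E.F0hat z (σ * q) < 1 - 3 * α / 4} := by
    intro z _
    by_cases h1 : E.Tobs z ≤ σ * q
    · exact .inl (.inr h1)
    by_cases h2 : E.F0hat z (σ * q) < 1 - 3 * α / 4
    · exact .inr h2
    refine .inl (.inl ?_)
    have := E.law_real_le_of_lt (not_le.1 h1)
    simp only [Set.mem_ofPred_eq]
    linarith
  have htotal : (1 : ℝ) ≤ _ := (probReal_univ (μ := E.dataLaw)).symm.trans_le
    ((measureReal_mono hcover).trans ((measureReal_union_le _ _).trans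
      (add_le_add_left (measureReal_union_le _ _) _)))
  linarith

/-- The bound that all claims rest on: up to `ε` the power is at least
`1 - F(q - τ/σ) - 4/(α²|𝒲|)`, for `q` the upper `α/2` point of `F`. -/
theorem exists_forall_powerAtLeast (F : Measure ℝ) {α q ε : ℝ} (hα : 0 < α)
    (hq : cdf F q = 1 - α / 2) (hε : 0 < ε) :
    ∃ L₀ : ℕ, ∀ n k : ℕ, 0 < n → k ∣ n → ∀ (E : Experiment.{u} n k) (σ τ : ℝ),
      PowerAssumptions E F σ τ → E.PowerAtLeast α L₀
        (1 - cdf F (q - τ / σ) - 4 / (α ^ 2 * (2 * n / k).choose (n / k)) - ε) := by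
  obtain ⟨L₀, hL₀⟩ := exists_nat_ge (max (8 / α) (16 / (α ^ 2 * ε)))
  rw [max_le_iff] at hL₀
  refine ⟨L₀, fun n k hn hkn E σ τ h => ?_⟩
  have hle := E.le_dataLaw_real_pValue_le hn hkn h hα hq
  refine ⟨?_, fun L hL => ?_⟩
  · have : E.dataLaw.real {z | E.event.law.real {w | E.Tobs z ≤ E.T w (E.Yobs z)} ≤ 3 * α / 4}
        ≤ E.exactPower α := measureReal_mono fun z hz => le_trans hz (show 3 * α / 4 ≤ α by linarith)
    linarith
  · have hL' : (L₀ : ℝ) ≤ L := by exact_mod_cast hL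
    have hpow := E.dataLaw_real_sub_le_power hn hkn hα (hL₀.1.trans hL')
    have hL0 : (0 : ℝ) < L := (by positivity : 0 < 8 / α).trans_le (hL₀.1.trans hL')
    have : 16 / (α ^ 2 * L) ≤ ε := by
      have := hL₀.2.trans hL'
      rw [div_le_iff₀ (by positivity)] at this ⊢
      linarith
    linarith

end Experiment

/-! ### The logistic bounds -/

theorem PowerAssumptions.scale_pos {n k : ℕ} {E : Experiment.{u} n k} {F : Measure ℝ} {σ τ : ℝ}
    (h : PowerAssumptions E F σ τ) : 0 < σ := by
  obtain ⟨_, _, _, _, _, _, hσ, _⟩ := h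
  exact hσ

theorem exists_cdf_eq {F : Measure ℝ} (hF : Continuous (cdf F)) {p : ℝ}
    (h0 : 0 < p) (h1 : p < 1) : ∃ q, cdf F q = p :=
  mem_range_of_exists_le_of_exists_ge hF
    ((tendsto_cdf_atBot F).eventually_le_const h0).exists
    ((tendsto_cdf_atTop F).eventually_const_le h1).exists

theorem exists_forall_cdf_sub_le (F : Measure ℝ) (q : ℝ) {ε : ℝ} (hε : 0 < ε) :
    ∃ x₀ : ℝ, 0 < x₀ ∧ ∀ x, x₀ ≤ x → cdf F (q - x) ≤ ε := by
  obtain ⟨y, hy⟩ := ((tendsto_cdf_atBot F).eventually_le_const hε).exists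
  refine ⟨max 1 (q - y), by positivity, fun x hx => ?_⟩
  have := (le_max_right _ _).trans hx
  exact (monotone_cdf F (by linarith)).trans hy

theorem logistic_le_one {A y : ℝ} (hA : 0 < A) : 1 / (1 + A * Real.exp y) ≤ 1 := by
  rw [div_le_one (by positivity)]
  have := Real.exp_pos y
  nlinarith

theorem logistic_le_of_le {A y ε : ℝ} (hA : 0 < A) (hε : 0 < ε) (h : 1 / ε ≤ A * Real.exp y) :
    1 / (1 + A * Real.exp y) ≤ ε := by
  rw [div_le_comm₀ (by positivity) hε]
  linarith

/-- A logistic curve that is below `ε` left of `x₀`. -/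
theorem logistic_le_of_le_threshold {ε x x₀ : ℝ} (hε : 0 < ε) (hx : x ≤ x₀) :
    1 / (1 + Real.exp x₀ / ε * Real.exp (-x)) ≤ ε := by
  refine logistic_le_of_le (by positivity) hε ?_
  rw [div_mul_eq_mul_div, ← Real.exp_add]
  gcongr
  exact Real.one_le_exp (by linarith)

/-- As `|𝒲| ≥ 1`, the Chebyshev error of order `|𝒲|⁻¹` is within the allowed `|𝒲|^(-1/2+δ)`. -/
theorem div_mul_le_mul_rpow {α δ M : ℝ} (hα : 0 < α) (hδ : 0 < δ) (hM : 1 ≤ M) :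
    4 / (α ^ 2 * M) ≤ 4 / α ^ 2 * M ^ (-(1 / 2 : ℝ) + δ) := by
  rw [← div_div, div_eq_mul_inv _ M, ← Real.rpow_neg_one]
  gcongr
  linarith

/-- A logistic curve in `τ/σ` bounds the power: `ε` absorbs `F(q - τ/σ)` for large `τ/σ`, and the
logistic term is below `ε` elsewhere. Where only an upper bound on `σ` is known, `y` is the resulting
lower bound of `τ/σ`, which is valid for positive effects only. -/
theorem exists_logistic_powerAtLeast (F : Measure ℝ) (hF : Continuous (cdf F)) {α ε : ℝ}
    (hα₀ : 0 < α) (hα₁ : α < 1) (hε : 0 < ε) :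
    ∃ A : ℝ, 0 < A ∧ ∃ L₀ : ℕ, ∀ n k : ℕ, 0 < n → k ∣ n →
      ∀ (E : Experiment.{u} n k) (σ τ y δ : ℝ), PowerAssumptions E F σ τ → 0 < δ →
        (0 < y → y ≤ τ / σ) → E.PowerAtLeast α L₀ (1 / (1 + A * Real.exp (-y))
          - 4 / α ^ 2 * ((2 * n / k).choose (n / k) : ℝ) ^ (-(1 / 2 : ℝ) + δ) - ε) := by
  obtain ⟨q, hq⟩ := exists_cdf_eq hF (p := 1 - α / 2) (by linarith) (by linarith)
  obtain ⟨x₀, hx₀, hcdf⟩ := exists_forall_cdf_sub_le F q (half_pos hε)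
  obtain ⟨L₀, hL₀⟩ := Experiment.exists_forall_powerAtLeast.{u} F hα₀ hq (half_pos hε)
  refine ⟨Real.exp x₀ / ε, by positivity, L₀, fun n k hn hkn E σ τ y δ h hδ hy => ?_⟩
  have hM : (1 : ℝ) ≤ (2 * n / k).choose (n / k) := by exact_mod_cast choose_blocks_pos n k
  rcases le_total x₀ y with hxy | hxy
  · refine (hL₀ n k hn hkn E σ τ h).mono ?_
    have h1 := hcdf _ (hxy.trans (hy (hx₀.trans_le hxy)))
    have h2 := div_mul_le_mul_rpow hα₀ hδ hM
    have h3 := logistic_le_one (A := Real.exp x₀ / ε) (y := -y) (by positivity)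
    linarith
  · refine E.powerAtLeast_of_nonpos ?_ L₀
    have h1 := logistic_le_of_le_threshold hε hxy
    have h2 : 0 ≤ 4 / α ^ 2 * ((2 * n / k).choose (n / k) : ℝ) ^ (-(1 / 2 : ℝ) + δ) := by
      positivity
    linarith

theorem mul_sqrt_le_div_of_scale_le {n k : ℕ} {σ τ c : ℝ} (hσ : 0 < σ) (hc : 0 < c)
    (hn : 0 < n) (hk : 0 < k) (hσc : σ ≤ c / √(2 * n * k : ℝ))
    (hτ : 0 ≤ τ) : τ / c * √(2 * n * k : ℝ) ≤ τ / σ := by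
  have hs : 0 < √(2 * n * k : ℝ) := by positivity
  rw [div_mul_eq_mul_div, div_le_div_iff₀ hc hσ]
  rw [le_div_iff₀ hs] at hσc
  nlinarith

/-- For a fixed effect, a large randomization space forces many blocks, hence many focal units and
a small scale, so that the power is eventually at least `α/2 - ε` for `τ = 0` and `1 - ε` for
`τ > 0`. For `τ < 0` the logistic term vanishes. -/
theorem exists_logistic_powerAtLeast_of_card_large (F : Measure ℝ) (hF : Continuous (cdf F))
    {α c : ℝ} (hα₀ : 0 < α) (hα₁ : α < 1) (hc : 0 < c) (τ : ℝ) {ε : ℝ} (hε : 0 < ε) :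
    ∃ m₀ L₀ : ℕ, ∀ n k : ℕ, 0 < n → k ∣ n → ∀ (E : Experiment.{u} n k) (σ : ℝ),
      PowerAssumptions E F σ τ → σ ≤ c / √(2 * n * k : ℝ) →
      m₀ ≤ (2 * n / k).choose (n / k) → E.PowerAtLeast α L₀
        (1 / (1 + (2 / α - 1) * Real.exp (-τ * √((2 * n / k).choose (n / k) : ℝ))) - ε) := by
  have hA : 0 < 2 / α - 1 := by
    rw [sub_pos, lt_div_iff₀ hα₀]; linarith
  obtain ⟨q, hq⟩ := exists_cdf_eq hF (p := 1 - α / 2) (by linarith) (by linarith)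
  obtain ⟨L₀, hL₀⟩ := Experiment.exists_forall_powerAtLeast.{u} F hα₀ hq
    (by positivity : 0 < ε / 3)
  obtain ⟨m₁, hm₁⟩ := exists_nat_ge (4 / (α ^ 2 * (ε / 3)))
  have herr : ∀ m : ℕ, 0 < m → m₁ ≤ m → 4 / (α ^ 2 * (m : ℝ)) ≤ ε / 3 := fun m hm0 hm => by
    have hm0' : (0 : ℝ) < m := by exact_mod_cast hm0
    have h1 : (m₁ : ℝ) ≤ m := by exact_mod_cast hm
    have h2 := hm₁.trans h1
    rw [div_le_iff₀ (by positivity)] at h2 ⊢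
    linarith
  rcases lt_trichotomy τ 0 with hτ | rfl | hτ
  · obtain ⟨m₂, hm₂⟩ := exists_nat_ge ((1 / ε / (2 / α - 1) / (-τ)) ^ 2)
    refine ⟨m₂, L₀, fun n k hn hkn E σ h hσ hm => E.powerAtLeast_of_nonpos ?_ L₀⟩
    have hM : (m₂ : ℝ) ≤ (2 * n / k).choose (n / k) := by exact_mod_cast hm
    have h1 := Real.le_sqrt_of_sq_le (hm₂.trans hM)
    rw [div_le_iff₀ (by linarith), div_le_iff₀ hA] at h1
    have h2 := Real.add_one_le_exp (-τ * √((2 * n / k).choose (n / k) : ℝ))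
    have h3 := logistic_le_of_le hA hε (y := -τ * √((2 * n / k).choose (n / k) : ℝ))
      (by nlinarith)
    linarith
  · refine ⟨m₁, L₀, fun n k hn hkn E σ h hσ hm => (hL₀ n k hn hkn E σ 0 h).mono ?_⟩
    have h1 := herr _ (choose_blocks_pos n k) hm
    have h2 : 1 / (1 + (2 / α - 1) * Real.exp (-0 * √((2 * n / k).choose (n / k) : ℝ)))
        = α / 2 := by
      simp
    rw [h2, zero_div, sub_zero, hq]
    linarith
  · obtain ⟨x₀, hx₀, hcdf⟩ := exists_forall_cdf_sub_le F q (by positivity : 0 < ε / 3)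
    obtain ⟨r, hr⟩ := exists_nat_ge ((x₀ / (τ / c)) ^ 2)
    refine ⟨max m₁ (2 ^ r), L₀, fun n k hn hkn E σ h hσ hm =>
      (hL₀ n k hn hkn E σ τ h).mono ?_⟩
    have hk := Nat.pos_of_dvd_of_pos hkn hn
    have h1 := herr _ (choose_blocks_pos n k) ((le_max_left _ _).trans hm)
    have hrn : r ≤ 2 * n * k := by
      have : 2 ^ r ≤ 2 ^ (2 * n / k) :=
        ((le_max_right _ _).trans hm).trans (Nat.choose_le_two_pow _ _)
      exact ((Nat.pow_le_pow_iff_right (by norm_num)).1 this).trans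
        ((Nat.div_le_self _ _).trans (Nat.le_mul_of_pos_right _ hk))
    have hrn' : (r : ℝ) ≤ 2 * n * k := by exact_mod_cast hrn
    have h2 := Real.le_sqrt_of_sq_le (hr.trans hrn')
    rw [div_le_iff₀ (by positivity), mul_comm] at h2
    have hσ0 := h.scale_pos
    have h3 := hcdf _ (h2.trans (mul_sqrt_le_div_of_scale_le hσ0 hc hn hk hσ hτ.le))
    have h4 := logistic_le_one (y := -τ * √((2 * n / k).choose (n / k) : ℝ)) hA
    linarith

end TwoSided

theorem proposition1 (F : Measure ℝ) [IsProbabilityMeasure F] (hF : Continuous (cdf F))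
    (α : ℝ) (hα₀ : 0 < α) (hα₁ : α < 1) :
    -- the displayed bound, for a fixed effect `τ` and a scale `σ = O(|𝒰|^(-1/2))`
    (∀ c : ℝ, 0 < c → ∃ A a : ℝ, 0 < A ∧ 0 < a ∧ ∀ δ : ℝ, 0 < δ → ∃ K : ℝ, 0 < K ∧
      ∀ τ ε : ℝ, 0 < ε → ∃ m₀ L₀ : ℕ,
      ∀ n k : ℕ, 0 < n → k ∣ n → ∀ (E : TwoSided.Experiment.{u} n k) (σ : ℝ),
        TwoSided.PowerAssumptions E F σ τ → σ ≤ c / √(2 * n * k : ℝ) →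
        m₀ ≤ (2 * n / k).choose (n / k) →
        E.PowerAtLeast α L₀
          (1 / (1 + A * Real.exp (-a * τ * √((2 * n / k).choose (n / k) : ℝ)))
            - K * (2 * n * k : ℝ) ^ (-(1 / 2 : ℝ) + δ) - ε)) ∧
    -- the same with the roles of `|𝒰| = 2nk` and `|𝒲|` interchanged, uniformly in `τ`
    (∀ c : ℝ, 0 < c → ∀ δ : ℝ, 0 < δ → ∃ K : ℝ, 0 < K ∧
      ∀ ε : ℝ, 0 < ε → ∃ A a : ℝ, 0 < A ∧ 0 < a ∧ ∃ L₀ : ℕ,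
      ∀ n k : ℕ, 0 < n → k ∣ n → ∀ (E : TwoSided.Experiment.{u} n k) (σ τ : ℝ),
        TwoSided.PowerAssumptions E F σ τ → σ ≤ c / √(2 * n * k : ℝ) →
        E.PowerAtLeast α L₀
          (1 / (1 + A * Real.exp (-a * τ * √(2 * n * k : ℝ)))
            - K * ((2 * n / k).choose (n / k) : ℝ) ^ (-(1 / 2 : ℝ) + δ) - ε)) ∧
    -- no assumption on the size of the scale `σ`
    (∀ δ : ℝ, 0 < δ → ∃ K : ℝ, 0 < K ∧
      ∀ ε : ℝ, 0 < ε → ∃ A a : ℝ, 0 < A ∧ 0 < a ∧ ∃ L₀ : ℕ,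
      ∀ n k : ℕ, 0 < n → k ∣ n → ∀ (E : TwoSided.Experiment.{u} n k) (σ τ : ℝ),
        TwoSided.PowerAssumptions E F σ τ →
        E.PowerAtLeast α L₀
          (1 / (1 + A * Real.exp (-a * τ / σ))
            - K * ((2 * n / k).choose (n / k) : ℝ) ^ (-(1 / 2 : ℝ) + δ) - ε)) := by
  refine ⟨fun c hc => ?_, fun c hc δ hδ => ?_, fun δ hδ => ?_⟩
  · have hA : 0 < 2 / α - 1 := by
      rw [sub_pos, lt_div_iff₀ hα₀]; linarith
    -- this bound holds without the `K` term, so any `K` will do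
    refine ⟨2 / α - 1, 1, hA, one_pos, fun δ hδ => ⟨1, one_pos, fun τ ε hε => ?_⟩⟩
    obtain ⟨m₀, L₀, h⟩ := TwoSided.exists_logistic_powerAtLeast_of_card_large.{u} F hF hα₀ hα₁ hc
      τ hε
    refine ⟨m₀, L₀, fun n k hn hkn E σ hE hσ hm => (h n k hn hkn E σ hE hσ hm).mono ?_⟩
    have : 0 ≤ 1 * (2 * n * k : ℝ) ^ (-(1 / 2 : ℝ) + δ) := by positivity
    rw [neg_one_mul]
    linarith
  · refine ⟨4 / α ^ 2, by positivity, fun ε hε => ?_⟩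
    obtain ⟨A, hA, L₀, h⟩ := TwoSided.exists_logistic_powerAtLeast.{u} F hF hα₀ hα₁ hε
    refine ⟨A, 1 / c, hA, by positivity, L₀, fun n k hn hkn E σ τ hE hσ => ?_⟩
    have hσ0 := hE.scale_pos
    have hk := Nat.pos_of_dvd_of_pos hkn hn
    have hy : -(1 / c) * τ * √(2 * n * k : ℝ) = -(τ / c * √(2 * n * k : ℝ)) := by ring
    rw [hy]
    refine h n k hn hkn E σ τ _ δ hE hδ fun hpos => ?_
    refine TwoSided.mul_sqrt_le_div_of_scale_le hσ0 hc hn hk hσ ?_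
    by_contra! hτ
    exact hpos.not_ge (mul_nonpos_of_nonpos_of_nonneg
      (div_nonpos_of_nonpos_of_nonneg hτ.le hc.le) (Real.sqrt_nonneg _))
  · refine ⟨4 / α ^ 2, by positivity, fun ε hε => ?_⟩
    obtain ⟨A, hA, L₀, h⟩ := TwoSided.exists_logistic_powerAtLeast.{u} F hF hα₀ hα₁ hε
    refine ⟨A, 1, hA, one_pos, L₀, fun n k hn hkn E σ τ hE => ?_⟩
    rw [neg_one_mul, neg_div]
    exact h n k hn hkn E σ τ _ δ hE hδ fun _ => le_rfl
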